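/- For a convex body $K\subset\mathbb R^n$ ($n\ge 1$, a compact convex set) with the origin in its interior, let $\|x\|=\min\{r\ge 0: x\in rK\}$ be the possibly asymmetric norm with unit ball $K$. In the notation $\|\cdot\|_T$ for the norm whose unit ball is $T^\circ=\{x:\langle p,x\rangle\le 1\ \forall p\in T\}$, it is $\|\cdot\|_{K^\circ}$, where $K^\circ=\{p\in(\mathbb R^n)^*:\langle p,x\rangle\le 1\ \forall x\in K\}$. For $m\ge 1$ let $\mathcal P_m(K)$ be the set of $m$-tuples $(q_1,\dots,q_m)$ of points of $\mathbb R^n$ such that $\{q_1,\dots,q_m\}$ is not contained in any $\alpha K+t$ with $\alpha\in(0,1)$, $t\in\mathbb R^n$. Define the length of a shortest generalized closed billiard trajectory by $$\xi_{K^\circ}(K)=\min_{m\ge1}\ \min_{(q_1,\dots,q_m)\in\mathcal P_m(K)}\ \sum_{i=1}^m\|q_{i+1}-q_i\|_{K^\circ}\qquad(q_{m+1}=q_1).$$ (1) For every convex body $K\subset\mathbb R^n$ with the origin in its interior, this minimum is attained and $$\xi_{K^\circ}(K)\ \ge\ 2+\frac2n .$$ (2) The bound is sharp: if $L\subset\mathbb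 R^n$ is any $n$-dimensional simplex with barycenter at the origin, then $L$ contains the origin in its interior and $\xi_{L^\circ}(L)=2+\frac2n$. (3) The constant is also optimal for smooth bodies with smooth polars: for every $\varepsilon>0$ there is a convex body $K\subset\mathbb R^n$ with the origin in its interior such that $K$ and $K^\circ$ have $C^\infty$ boundaries and $\xi_{K^\circ}(K)<2+\frac2n+\varepsilon$. -/

import Mathlib

open scoped ContDiff

noncomputable section

namespace Billiard

variable {V : Type*} [NormedAddCommGroup V] [NormedSpace ℝ V]

/-- The (one-sided) polar `K° = {p | ⟨p, x⟩ ≤ 1 for all x ∈ K}` in the dual space of a subset `K`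
of `V`. -/
def polar (K : Set V) : Set (StrongDual ℝ V) :=
  {p | ∀ x ∈ K, p x ≤ 1}

/-- The (one-sided) polar `T° = {x | ⟨p, x⟩ ≤ 1 for all p ∈ T}` in `V` of a subset `T` of the dual
space of `V`. -/
def prepolar (T : Set (StrongDual ℝ V)) : Set V :=
  {x | ∀ p ∈ T, p x ≤ 1}

/-- The possibly asymmetric norm `‖·‖_T` on `V` with unit ball `T°`, for `T` in the dual space. -/
def asymNorm (T : Set (StrongDual ℝ V)) (x : V) : ℝ :=
  gauge (prepolar T) x

/-- The `‖·‖_T`-length of the closed polygonal line `q₁, …, qₘ`; the permutation `finRotate m` of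
the indices is the cyclic shift `i ↦ i + 1` modulo `m`. -/
def closedLength (T : Set (StrongDual ℝ V)) {m : ℕ} (q : Fin m → V) : ℝ :=
  ∑ i, asymNorm T (q (finRotate m i) - q i)

/-- The set `𝒫ₘ(K)` of all `m`-tuples of points that do not fit into any smaller homothet
`α K + t`, `0 < α < 1`, of `K`. -/
def unfit (m : ℕ) (K : Set V) : Set (Fin m → V) :=
  {q | ¬ ∃ α : ℝ, 0 < α ∧ α < 1 ∧ ∃ t : V, Set.range q ⊆ (fun x => α • x + t) '' K}

/-- The `‖·‖_T`-lengths of all closed polygonal lines, with any number `m ≥ 1` of vertices, that do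
not fit into a smaller homothet of `K`. -/
def unfitLengths (T : Set (StrongDual ℝ V)) (K : Set V) : Set ℝ :=
  {l | ∃ m : ℕ, 1 ≤ m ∧ ∃ q ∈ unfit m K, l = closedLength T q}

/-- The length `ξ_T(K)` of a shortest generalized closed billiard trajectory in `K` with the norm
`‖·‖_T`. -/
def xi (T : Set (StrongDual ℝ V)) (K : Set V) : ℝ :=
  sInf (unfitLengths T K)

/-- `K` has a smooth boundary: near each boundary point, `K` is the sublevel set `{φ ≤ 0}` of a
`C^∞` function `φ` whose differential does not vanish at that point. -/
def HasSmoothBoundary (K : Set V) : Prop :=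
  ∀ x ∈ frontier K, ∃ U : Set V, IsOpen U ∧ x ∈ U ∧ ∃ φ : V → ℝ,
    ContDiffOn ℝ ∞ φ U ∧ fderiv ℝ φ x ≠ 0 ∧ ∀ y ∈ U, y ∈ K ↔ φ y ≤ 0

/-- A convex body (compact convex set) with the origin in its interior. -/
structure IsBodyAroundZero (K : Set V) : Prop where
  convex : Convex ℝ K
  isCompact : IsCompact K
  zero_mem_interior : (0 : V) ∈ interior K

end Billiard

end

open scoped ContDiff

noncomputable section

namespace Billiard

/-! ### Asymmetric norms, closed polygonal lines and the weighted-centre estimate. -/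

section

variable {V : Type*} [NormedAddCommGroup V] [NormedSpace ℝ V]

namespace IsBodyAroundZero

variable {K : Set V}

/-! Put `n = dim V`. A tuple fits into a smaller homothet iff some `t` satisfies `gauge K (q i - t)
< 1` for all `i`. By Helly's theorem `n + 1` vertices suffice to obstruct this, and by the triangle
inequality dropping vertices does not lengthen the line. So only `(n + 1)`-gons matter, and after a
translation a compactness argument gives a minimizer (`isLeast_xi`).

Lower bound (`exists_gauge_sub_lt_one`): weight each vertex of a closed line of length `L` by the
length of its incoming edge, and let `t` be the weighted centre. The weighted mean of the forward
path lengths to `b` does not depend on `b`. Since the forward paths from `a` to `b` and from `b` to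
`a` add up to `L`, this mean equals `(L ^ 2 - ∑ w ^ 2) / (2 * L)`, which by Cauchy-Schwarz is at
most `L * n / (2 * (n + 1))`. If `L < 2 + 2 / n` this is below `1`, and the line fits.

Upper bound (`xi_le`): in a simplex `y j ≤ 1` with `∑ y j = 0`, take a polygon whose vertices are
cyclic shifts of equally spaced values in `[-1, 1]`. It touches every facet, and each of its `n + 1`
edges has length at most `2 / n`. The estimate survives for bodies squeezed between `ρ` times the
simplex and the simplex. Sublevel sets of sums of exponentials are such bodies. They are smooth, and
so are their polars, by the inverse function theorem applied to the Lagrange multiplier equations.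
-/

theorem mem_nhds (hK : IsBodyAroundZero K) : K ∈ nhds (0 : V) :=
  mem_interior_iff_mem_nhds.1 hK.zero_mem_interior

theorem zero_mem (hK : IsBodyAroundZero K) : (0 : V) ∈ K :=
  interior_subset hK.zero_mem_interior

theorem absorbent (hK : IsBodyAroundZero K) : Absorbent ℝ K :=
  absorbent_nhds_zero hK.mem_nhds

theorem gauge_add_le (hK : IsBodyAroundZero K) (x y : V) :
    gauge K (x + y) ≤ gauge K x + gauge K y :=
  _root_.gauge_add_le hK.convex hK.absorbent x y

theorem gauge_sub_le (hK : IsBodyAroundZero K) (x y z : V) :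
    gauge K (z - x) ≤ gauge K (y - x) + gauge K (z - y) := by
  have := hK.gauge_add_le (y - x) (z - y)
  rwa [show y - x + (z - y) = z - x by abel] at this

theorem continuous_gauge (hK : IsBodyAroundZero K) : Continuous (gauge K) :=
  _root_.continuous_gauge hK.convex hK.mem_nhds

theorem gauge_le_one_iff (hK : IsBodyAroundZero K) {x : V} : gauge K x ≤ 1 ↔ x ∈ K := by
  rw [gauge_le_one_iff_mem_closure hK.convex hK.mem_nhds, hK.isCompact.isClosed.closure_eq]

theorem gauge_le_iff (hK : IsBodyAroundZero K) {r : ℝ} (hr : 0 < r) {x : V} :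
    gauge K x ≤ r ↔ r⁻¹ • x ∈ K := by
  rw [← hK.gauge_le_one_iff, gauge_smul_of_nonneg (inv_nonneg.2 hr.le), smul_eq_mul,
    inv_mul_le_iff₀ hr, mul_one]

theorem exists_norm_le (hK : IsBodyAroundZero K) :
    ∃ R : ℝ, 0 < R ∧ ∀ x, ‖x‖ ≤ R * gauge K x := by
  obtain ⟨R, hR, h⟩ := hK.isCompact.isBounded.subset_closedBall_lt 0 (0 : V)
  refine ⟨R, hR, fun x => ?_⟩
  have := le_gauge_of_subset_closedBall (x := x) hK.absorbent hR.le h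
  rwa [div_le_iff₀' hR] at this

theorem prepolar_polar (hK : IsBodyAroundZero K) : prepolar (polar K) = K := by
  ext x
  constructor
  · intro hx
    by_contra hxK
    obtain ⟨f, u, hf, hu⟩ := geometric_hahn_banach_closed_point hK.convex hK.isCompact.isClosed hxK
    have hu0 : 0 < u := by simpa using hf 0 hK.zero_mem
    have h1 : u⁻¹ • f ∈ polar K := by
      intro y hy
      have := (hf y hy).le
      simp only [smul_apply, smul_eq_mul]
      rwa [inv_mul_le_iff₀ hu0, mul_one]
    have h2 := hx _ h1
    simp only [smul_apply, smul_eq_mul] at h2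
    rw [inv_mul_le_iff₀ hu0, mul_one] at h2
    linarith
  · intro hx p hp
    exact hp x hx

theorem closedLength_polar (hK : IsBodyAroundZero K) {m : ℕ} (q : Fin m → V) :
    closedLength (polar K) q = ∑ i, gauge K (q (finRotate m i) - q i) := by
  simp only [closedLength, asymNorm, hK.prepolar_polar]

theorem mem_unfit_iff (hK : IsBodyAroundZero K) {m : ℕ} (q : Fin m → V) :
    q ∈ unfit m K ↔ ∀ t, ∃ i, 1 ≤ gauge K (q i - t) := by
  rw [← not_iff_not]
  simp only [unfit, Set.mem_ofPred_eq, not_not, not_forall, not_exists, not_le]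
  constructor
  · rintro ⟨α, h0, h1, t, ht⟩
    refine ⟨t, fun i => ?_⟩
    obtain ⟨x, hx, hxi⟩ := ht ⟨i, rfl⟩
    refine lt_of_le_of_lt ((hK.gauge_le_iff h0).2 ?_) h1
    have : q i = α • x + t := hxi.symm
    rw [this, add_sub_cancel_right, smul_smul, inv_mul_cancel₀ h0.ne', one_smul]
    exact hx
  · rintro ⟨t, ht⟩
    -- Finitely many gauges below `1` have a maximum below `1`, which leaves room for `α`.
    have : ∃ α : ℝ, 0 < α ∧ α < 1 ∧ ∀ i, gauge K (q i - t) ≤ α := by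
      cases isEmpty_or_nonempty (Fin m) with
      | inl h => exact ⟨1 / 2, by norm_num, by norm_num, fun i => isEmptyElim i⟩
      | inr h =>
        obtain ⟨j, hj⟩ := Finite.exists_max fun i => gauge K (q i - t)
        obtain ⟨α, h1, h2⟩ := exists_between (ht j)
        exact ⟨α, (gauge_nonneg _).trans_lt h1, h2, fun i => (hj i).trans h1.le⟩
    obtain ⟨α, h0, h1, h⟩ := this
    refine ⟨α, h0, h1, t, ?_⟩
    rintro _ ⟨i, rfl⟩
    refine ⟨α⁻¹ • (q i - t), (hK.gauge_le_iff h0).1 (h i), ?_⟩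
    simp [smul_smul, mul_inv_cancel₀ h0.ne']

end IsBodyAroundZero

/-- Arc length parameters of the vertices of a closed polygonal line. -/
theorem IsBodyAroundZero.exists_arclength {K : Set V} (hK : IsBodyAroundZero K) {m : ℕ}
    (q : Fin (m + 1) → V) :
    ∃ s : Fin (m + 1) → ℝ, (∀ a b, a ≤ b → gauge K (q b - q a) ≤ s b - s a) ∧
      ∀ a b, gauge K (q b - q a) ≤
        s b - s a + ∑ i, gauge K (q (finRotate (m + 1) i) - q i) := by
  set l : Fin m → ℝ := fun i => gauge K (q i.succ - q i.castSucc) with hl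
  set s : Fin (m + 1) → ℝ := fun j => ∑ i : Fin m, if i.castSucc < j then l i else 0 with hs
  have hs0 : s 0 = 0 := by simp [hs]
  have hlast : s (Fin.last m) = ∑ i, l i := by simp [hs, Fin.castSucc_lt_last]
  have hstep : ∀ i : Fin m, s i.succ = s i.castSucc + l i := by
    intro i
    rw [← sub_eq_iff_eq_add', hs]
    simp only
    rw [← Finset.sum_sub_distrib, Finset.sum_eq_single i]
    · simp
    · intro b _ hb
      have : (b : ℕ) ≠ i := fun h => hb (Fin.ext h)
      have h1 : b.castSucc < i.succ ↔ b.castSucc < i.castSucc := by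
        simp only [Fin.lt_def, Fin.val_castSucc, Fin.val_succ]; omega
      simp [h1]
    · simp
  have hA : ∀ a b, a ≤ b → gauge K (q b - q a) ≤ s b - s a := by
    intro a b
    induction b using Fin.induction with
    | zero =>
      intro h
      have : a = 0 := le_antisymm h (Fin.zero_le _)
      simp [this]
    | succ i ih =>
      intro h
      rcases h.eq_or_lt with rfl | h
      · simp
      · have h' : a ≤ i.castSucc := Fin.le_castSucc_iff.2 h
        have h1 := ih h'
        have h2 := hK.gauge_sub_le (q a) (q i.castSucc) (q i.succ)
        rw [hstep]
        linarith
  refine ⟨s, hA, fun a b => ?_⟩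
  have hL : ∑ i, gauge K (q (finRotate (m + 1) i) - q i) =
      s (Fin.last m) + gauge K (q 0 - q (Fin.last m)) := by
    rw [Fin.sum_univ_castSucc, hlast, finRotate_last]
    congr 1
    refine Finset.sum_congr rfl fun i _ => ?_
    rw [hl]
    congr 3
    simp
  rw [hL]
  have h1 := hK.gauge_sub_le (q a) (q 0) (q b)
  have h2 := hK.gauge_sub_le (q a) (q (Fin.last m)) (q 0)
  have h3 := hA 0 b (Fin.zero_le _)
  have h4 := hA a _ (Fin.le_last a)
  rw [hs0] at h3
  linarith

/-- Passing to a cyclic subsequence of vertices does not increase the length. -/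
theorem IsBodyAroundZero.length_comp_le {K : Set V} (hK : IsBodyAroundZero K) {m k : ℕ}
    (q : Fin (m + 1) → V) (e : Fin (k + 1) → Fin (m + 1)) (he : Monotone e) :
    ∑ i, gauge K (q (e (finRotate (k + 1) i)) - q (e i)) ≤
      ∑ i, gauge K (q (finRotate (m + 1) i) - q i) := by
  obtain ⟨s, h1, h2⟩ := hK.exists_arclength q
  set L := ∑ i, gauge K (q (finRotate (m + 1) i) - q i)
  calc ∑ i, gauge K (q (e (finRotate (k + 1) i)) - q (e i))
      ≤ ∑ i, (s (e (finRotate (k + 1) i)) - s (e i) + if i = Fin.last k then L else 0) := by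
        refine Finset.sum_le_sum fun i _ => ?_
        -- Only the closing edge passes the starting vertex, so it alone pays the full turn `L`; the
        -- rest telescopes.
        split_ifs with h
        · exact h2 _ _
        · rw [add_zero]
          refine h1 _ _ (he ?_)
          rw [Fin.le_def, coe_finRotate, if_neg h]
          omega
    _ = L := by
        rw [Finset.sum_add_distrib, Finset.sum_sub_distrib,
          Equiv.sum_comp (finRotate (k + 1)) fun i => s (e i)]
        simp

/-- Short closed polygonal lines with `k + 1` vertices fit into a smaller homothet. -/
theorem IsBodyAroundZero.exists_gauge_sub_lt_one {K : Set V} (hK : IsBodyAroundZero K) {k : ℕ}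
    (q : Fin (k + 1) → V)
    (hq : (∑ i, gauge K (q (finRotate (k + 1) i) - q i)) * k < 2 * (k + 1)) :
    ∃ t, ∀ i, gauge K (q i - t) < 1 := by
  obtain ⟨s, h1, h2⟩ := hK.exists_arclength q
  -- The maximum with `1` makes `L` positive even for a constant line; any excess is absorbed by the
  -- closing edge in `w 0`.
  obtain ⟨L, hL0, hL, hLk⟩ : ∃ L : ℝ, 0 < L ∧
      ∑ i, gauge K (q (finRotate (k + 1) i) - q i) ≤ L ∧ L * k < 2 * (k + 1) := by
    refine ⟨max (∑ i, gauge K (q (finRotate (k + 1) i) - q i)) 1,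
      zero_lt_one.trans_le (le_max_right _ _), le_max_left _ _, ?_⟩
    rcases max_choice (∑ i, gauge K (q (finRotate (k + 1) i) - q i)) 1 with h | h <;> rw [h]
    · exact hq
    · have : (0 : ℝ) ≤ k := k.cast_nonneg
      linarith
  -- `d a b` is the forward path length from `a` to `b`; below, `w a` is the length of the edge
  -- arriving at `a`.
  set d : Fin (k + 1) → Fin (k + 1) → ℝ := fun a b => s b - s a + if b < a then L else 0 with hd
  have hgd : ∀ a b, gauge K (q b - q a) ≤ d a b := by
    intro a b
    simp only [hd]
    split_ifs with h
    · exact (h2 a b).trans (by linarith)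
    · rw [add_zero]; exact h1 a b (not_lt.1 h)
  set w : Fin (k + 1) → ℝ :=
    Fin.cons (s 0 - s (Fin.last k) + L) fun i => s i.succ - s i.castSucc with hw
  have hw0 : ∀ a, 0 ≤ w a := by
    intro a
    induction a using Fin.cases with
    | zero =>
      have := (gauge_nonneg _).trans (h2 (Fin.last k) 0)
      simp only [hw, Fin.cons_zero]; linarith
    | succ i =>
      simp only [hw, Fin.cons_succ]
      exact (gauge_nonneg _).trans (h1 _ _ (Fin.castSucc_lt_succ).le)
  have tel : ∀ u : Fin (k + 1) → ℝ,
      ∑ i : Fin k, (u i.succ - u i.castSucc) = u (Fin.last k) - u 0 := by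
    intro u
    have e1 := Fin.sum_univ_succ u
    have e2 := Fin.sum_univ_castSucc u
    rw [Finset.sum_sub_distrib]
    linarith
  have hsum : ∑ a, w a = L := by
    rw [Fin.sum_univ_succ]
    simp only [hw, Fin.cons_zero, Fin.cons_succ]
    rw [tel s]; ring
  have htail : ∀ b, ∑ a, w a * (if b < a then L else 0) = L * (s (Fin.last k) - s b) := by
    intro b
    rw [Fin.sum_univ_succ, if_neg (by simp)]
    -- Telescoping a sequence truncated before `b` picks out exactly the edges arriving after `b`.
    have := tel fun j => if b ≤ j then L * (s j - s b) else 0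
    simp only [Fin.le_last, if_true] at this
    have h0 : (if b ≤ 0 then L * (s 0 - s b) else 0) = 0 := by
      split_ifs with h
      · rw [le_antisymm h (Fin.zero_le _)]; simp
      · rfl
    rw [h0, sub_zero] at this
    rw [mul_zero, zero_add, ← this]
    refine Finset.sum_congr rfl fun i _ => ?_
    simp only [hw, Fin.cons_succ]
    by_cases h : b ≤ i.castSucc
    · have h' : b < i.succ := Fin.le_castSucc_iff.1 h
      rw [if_pos h, if_pos h', if_pos h'.le]; ring
    · have h' : ¬ b < i.succ := fun hh => h (Fin.le_castSucc_iff.2 hh)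
      rw [if_neg h, if_neg h']
      split_ifs with h''
      · have : b = i.succ := le_antisymm h'' (not_lt.1 h')
        rw [this]; ring
      · ring
  set C := L * s (Fin.last k) - ∑ a, w a * s a with hC
  -- Moving `b` to its successor adds the new edge length to every path except the one starting at
  -- that successor, which drops by the complementary length; the weights make these changes cancel.
  have hconst : ∀ b, ∑ a, w a * d a b = C := by
    intro b
    have : ∀ a, w a * d a b = w a * s b - w a * s a + w a * (if b < a then L else 0) := by
      intro a; simp only [hd]; ring
    simp only [this]
    rw [Finset.sum_add_distrib, Finset.sum_sub_distrib, htail, ← Finset.sum_mul, hsum]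
    ring
  have hsq : L ^ 2 ≤ (k + 1) * ∑ a, w a ^ 2 := by
    have := sq_sum_le_card_mul_sum_sq (s := Finset.univ) (f := w)
    rw [hsum] at this
    simpa using this
  -- Average over `b` with weights `w b` and symmetrize: `d a b + d b a` is `L` off the diagonal and
  -- `0` on it.
  have hLC : 2 * (L * C) = L * (L ^ 2 - ∑ a, w a ^ 2) := by
    have e1 : L * C = ∑ b, ∑ a, w b * (w a * d a b) := by
      simp only [← Finset.mul_sum, hconst]
      rw [← Finset.sum_mul, hsum]
    have e2 : L * C = ∑ b, ∑ a, w a * (w b * d b a) := by rw [Finset.sum_comm, e1]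
    have e3 : L * (L ^ 2 - ∑ a, w a ^ 2) =
        ∑ b, ∑ a, (L * (w b * w a) - if a = b then L * w a ^ 2 else 0) := by
      simp only [Finset.sum_sub_distrib, Finset.sum_ite_eq', Finset.mem_univ, if_true,
        ← Finset.mul_sum]
      rw [← Finset.sum_mul, hsum]
      ring
    rw [two_mul]
    nth_rw 1 [e1]
    rw [e2, e3]
    simp only [← Finset.sum_add_distrib]
    refine Finset.sum_congr rfl fun b _ => Finset.sum_congr rfl fun a _ => ?_
    simp only [hd]
    rcases lt_trichotomy a b with h | h | h
    · rw [if_neg h.not_gt, if_pos h, if_neg h.ne]; ring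
    · subst h; simp; ring
    · rw [if_pos h, if_neg h.not_gt, if_neg h.ne']; ring
  have hCL : C < L := by
    have hk : (0 : ℝ) < k + 1 := by positivity
    have e1 : 2 * C = L ^ 2 - ∑ a, w a ^ 2 := by
      apply mul_left_cancel₀ hL0.ne'
      linarith
    have e2 : 2 * ((k + 1) * C) ≤ L ^ 2 * k := by
      nlinarith
    have e3 : L ^ 2 * k < L * (2 * (k + 1)) := by nlinarith
    by_contra hcon
    push Not at hcon
    nlinarith
  refine ⟨∑ a, (w a / L) • q a, fun b => ?_⟩
  have hwL : ∑ a, w a / L = 1 := by rw [← Finset.sum_div, hsum, div_self hL0.ne']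
  have : q b - ∑ a, (w a / L) • q a = ∑ a, (w a / L) • (q b - q a) := by
    simp only [smul_sub, Finset.sum_sub_distrib]
    rw [← Finset.sum_smul, hwL, one_smul]
  rw [this]
  calc gauge K (∑ a, (w a / L) • (q b - q a))
      ≤ ∑ a, gauge K ((w a / L) • (q b - q a)) := gauge_sum_le hK.convex hK.absorbent _ _
    _ ≤ ∑ a, (w a / L) * d a b := by
        refine Finset.sum_le_sum fun a _ => ?_
        have h0 : 0 ≤ w a / L := div_nonneg (hw0 a) hL0.le
        rw [gauge_smul_of_nonneg h0, smul_eq_mul]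
        exact mul_le_mul_of_nonneg_left (hgd a b) h0
    _ = C / L := by
        rw [← hconst b, Finset.sum_div]
        exact Finset.sum_congr rfl fun a _ => by ring
    _ < 1 := by rwa [div_lt_one hL0]

end

/-! ### Helly reduction, existence of a minimizer, and the two bounds. -/

section

variable {V : Type*} [NormedAddCommGroup V] [NormedSpace ℝ V]

namespace IsBodyAroundZero

variable {K : Set V}

theorem convex_gauge_sub_lt_one (hK : IsBodyAroundZero K) (x : V) :
    Convex ℝ {t | gauge K (x - t) < 1} := by
  simp only [gauge_lt_one_iff_mem_interior hK.convex hK.mem_nhds]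
  intro t ht u hu a b ha hb hab
  have := hK.convex.interior ht hu ha hb hab
  rw [Set.mem_ofPred_eq]
  convert this using 1
  nth_rw 1 [← one_smul ℝ x]
  rw [← hab]
  module

/-- By Helly's theorem, `dim V + 1` of the vertices already do not fit. -/
theorem exists_monotone_comp_mem_unfit [FiniteDimensional ℝ V] (hK : IsBodyAroundZero K) {m : ℕ}
    (q : Fin (m + 1) → V) (hq : q ∈ unfit (m + 1) K) :
    ∃ e : Fin (Module.finrank ℝ V + 1) → Fin (m + 1), Monotone e ∧
      q ∘ e ∈ unfit (Module.finrank ℝ V + 1) K := by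
  rcases le_total m (Module.finrank ℝ V) with h | h
  -- With too few vertices for Helly, the last one is repeated.
  · refine ⟨fun i => ⟨min i m, by omega⟩, fun i j hij => ?_, ?_⟩
    · simp only [Fin.mk_le_mk]
      have : (i : ℕ) ≤ j := hij
      omega
    · rw [hK.mem_unfit_iff] at hq ⊢
      intro t
      obtain ⟨i, hi⟩ := hq t
      refine ⟨⟨i, by omega⟩, ?_⟩
      have : (⟨min (i : ℕ) m, by omega⟩ : Fin (m + 1)) = i := Fin.ext (by simp; omega)
      simpa [this] using hi
  · by_contra! hcon
    rw [hK.mem_unfit_iff] at hq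
    have := Convex.helly_theorem (𝕜 := ℝ) (F := fun i => {t | gauge K (q i - t) < 1})
      (s := Finset.univ) (by simpa using h) (fun i _ => hK.convex_gauge_sub_lt_one (q i)) ?_
    · obtain ⟨t, ht⟩ := this
      obtain ⟨i, hi⟩ := hq t
      simp only [Finset.mem_univ, Set.iInter_true, Set.mem_iInter, Set.mem_ofPred_eq] at ht
      exact absurd (ht i) hi.not_gt
    · intro I _ hI
      have h1 := hcon (I.orderEmbOfFin hI) (I.orderEmbOfFin hI).monotone
      rw [hK.mem_unfit_iff] at h1
      push Not at h1
      obtain ⟨t, ht⟩ := h1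
      refine ⟨t, ?_⟩
      simp only [Set.mem_iInter, Set.mem_ofPred_eq]
      intro i hi
      have : i ∈ Set.range (I.orderEmbOfFin hI) := by
        rw [Finset.range_orderEmbOfFin]; exact hi
      obtain ⟨j, rfl⟩ := this
      exact ht j

theorem isClosed_unfit (hK : IsBodyAroundZero K) (m : ℕ) : IsClosed (unfit m K) := by
  have : unfit m K = (⋃ t, ⋂ i, {q : Fin m → V | gauge K (q i - t) < 1})ᶜ := by
    ext q
    rw [hK.mem_unfit_iff]
    simp
  rw [this, isClosed_compl_iff]
  refine isOpen_iUnion fun t => isOpen_iInter_of_finite fun i => ?_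
  exact isOpen_lt (hK.continuous_gauge.comp (by fun_prop)) continuous_const

theorem continuous_length (hK : IsBodyAroundZero K) (m : ℕ) :
    Continuous fun q : Fin m → V => ∑ i, gauge K (q (finRotate m i) - q i) :=
  continuous_finsetSum _ fun _ _ => hK.continuous_gauge.comp (by fun_prop)

theorem sub_mem_unfit (hK : IsBodyAroundZero K) {m : ℕ} {q : Fin m → V} (hq : q ∈ unfit m K)
    (x : V) : (fun i => q i - x) ∈ unfit m K := by
  rw [hK.mem_unfit_iff] at hq ⊢
  intro t
  obtain ⟨i, hi⟩ := hq (x + t)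
  exact ⟨i, by rwa [sub_sub]⟩

theorem unfit_nonempty [Nontrivial V] (hK : IsBodyAroundZero K) {k : ℕ} (hk : 1 ≤ k) :
    (unfit (k + 1) K).Nonempty := by
  obtain ⟨R, hR, h⟩ := hK.exists_norm_le
  obtain ⟨x, hx⟩ := NormedSpace.exists_lt_norm ℝ V (2 * R)
  -- Two points too far apart for any translate of `K`; all remaining vertices sit at the origin.
  refine ⟨Pi.single 0 x, ?_⟩
  rw [hK.mem_unfit_iff]
  by_contra! hcon
  obtain ⟨t, ht⟩ := hcon
  have h0 := ht 0
  have h1 := ht ⟨1, by omega⟩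
  rw [Pi.single_eq_same] at h0
  rw [Pi.single_eq_of_ne (by simp [Fin.ext_iff])] at h1
  have e0 := h (x - t)
  have e1 := h (0 - t)
  have e2 := norm_sub_le (x - t) (0 - t)
  rw [show x - t - (0 - t) = x by abel] at e2
  nlinarith

theorem _root_.Billiard.bddBelow_unfitLengths (T : Set (StrongDual ℝ V)) (K : Set V) :
    BddBelow (unfitLengths T K) := by
  refine ⟨0, ?_⟩
  rintro _ ⟨m, _, q, _, rfl⟩
  exact Finset.sum_nonneg fun i _ => gauge_nonneg _

theorem isLeast_xi [FiniteDimensional ℝ V] [Nontrivial V] (hK : IsBodyAroundZero K) :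
    IsLeast (unfitLengths (polar K) K) (xi (polar K) K) := by
  set n := Module.finrank ℝ V with hn
  have hn1 : 1 ≤ n := Module.finrank_pos
  obtain ⟨R, hR, hnorm⟩ := hK.exists_norm_le
  obtain ⟨p, hp⟩ := hK.unfit_nonempty hn1
  set len : (Fin (n + 1) → V) → ℝ := fun q => ∑ i, gauge K (q (finRotate (n + 1) i) - q i)
    with hlen
  have hcl : Continuous len := hK.continuous_length _
  have hlensub : ∀ q x, len (fun i => q i - x) = len q := by
    intro q x
    simp [hlen]
  -- Fixing the first vertex removes translations, and the length bound then bounds every vertex.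
  set S : Set (Fin (n + 1) → V) := {q | q 0 = 0} ∩ unfit (n + 1) K ∩ {q | len q ≤ len p} with hS
  have hSc : IsClosed S :=
    ((isClosed_eq (continuous_apply 0) continuous_const).inter (hK.isClosed_unfit _)).inter
      (isClosed_le hcl continuous_const)
  have hSb : S ⊆ Metric.closedBall 0 (R * len p) := by
    rintro q ⟨⟨h0, -⟩, hq⟩
    have h0 : q 0 = 0 := h0
    have hq : len q ≤ len p := hq
    have hp0 : 0 ≤ len p := Finset.sum_nonneg fun i _ => gauge_nonneg _
    rw [mem_closedBall_zero_iff, pi_norm_le_iff_of_nonneg (mul_nonneg hR.le hp0)]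
    intro i
    obtain ⟨s, h1, h2⟩ := hK.exists_arclength q
    refine (hnorm _).trans (mul_le_mul_of_nonneg_left ?_ hR.le)
    have e1 := h1 0 i (Fin.zero_le _)
    have e2 := (gauge_nonneg _).trans (h2 i 0)
    rw [h0, sub_zero] at e1
    have e3 : 0 ≤ s 0 - s i + len q := e2
    linarith
  have hScomp : IsCompact S :=
    (isCompact_closedBall _ _).of_isClosed_subset hSc hSb
  have hpS : (fun i => p i - p 0) ∈ S :=
    ⟨⟨sub_self _, hK.sub_mem_unfit hp _⟩, (hlensub p _).le⟩
  obtain ⟨q, hqS, hmin⟩ := hScomp.exists_isMinOn ⟨_, hpS⟩ hcl.continuousOn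
  have hmin' : ∀ r ∈ unfit (n + 1) K, len q ≤ len r := by
    intro r hr
    rcases le_total (len r) (len p) with h | h
    · have hrS : (fun i => r i - r 0) ∈ S :=
        ⟨⟨sub_self _, hK.sub_mem_unfit hr _⟩, (hlensub r _).le.trans h⟩
      exact (isMinOn_iff.1 hmin _ hrS).trans_eq (hlensub r (r 0))
    · exact (show len q ≤ len p from hqS.2).trans h
  have hleast : IsLeast (unfitLengths (polar K) K) (len q) := by
    refine ⟨⟨n + 1, by omega, q, hqS.1.2, (hK.closedLength_polar q).symm⟩, ?_⟩
    rintro _ ⟨m, hm, r, hr, rfl⟩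
    obtain ⟨m, rfl⟩ : ∃ k, m = k + 1 := ⟨m - 1, by omega⟩
    obtain ⟨e, he, her⟩ := hK.exists_monotone_comp_mem_unfit r hr
    rw [hK.closedLength_polar]
    exact (hmin' _ her).trans (hK.length_comp_le r e he)
  have : xi (polar K) K = len q := hleast.csInf_eq
  rwa [this]

theorem le_xi [FiniteDimensional ℝ V] [Nontrivial V] (hK : IsBodyAroundZero K) :
    2 + 2 / (Module.finrank ℝ V : ℝ) ≤ xi (polar K) K := by
  obtain ⟨m, hm, r, hr, hx⟩ := hK.isLeast_xi.1
  obtain ⟨m, rfl⟩ : ∃ k, m = k + 1 := ⟨m - 1, by omega⟩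
  obtain ⟨e, he, her⟩ := hK.exists_monotone_comp_mem_unfit r hr
  rw [hx, hK.closedLength_polar]
  refine le_trans ?_ (hK.length_comp_le r e he)
  have hn0 : (0 : ℝ) < Module.finrank ℝ V := Nat.cast_pos.2 Module.finrank_pos
  by_contra! hcon
  obtain ⟨t, ht⟩ := hK.exists_gauge_sub_lt_one (r ∘ e) (by
    have := mul_lt_mul_of_pos_right hcon hn0
    rw [show (2 + 2 / (Module.finrank ℝ V : ℝ)) * Module.finrank ℝ V =
      2 * (Module.finrank ℝ V + 1) by field_simp] at this
    exact this)
  obtain ⟨i, hi⟩ := (hK.mem_unfit_iff _).1 her t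
  exact absurd (ht i) hi.not_gt

/-- An upper bound for the shortest length in bodies close to a simplex `{x | ∀ j, y j x ≤ 1}`. -/
theorem xi_le (hK : IsBodyAroundZero K) {n : ℕ} (hn : 1 ≤ n) (y : Fin (n + 1) → V →ₗ[ℝ] ℝ)
    (hy : ∀ x, ∑ j, y j x = 0) (hy1 : ∀ x ∈ K, ∀ j, y j x ≤ 1)
    (hex : ∀ a : Fin (n + 1) → ℝ, ∑ j, a j = 0 → ∃ x, ∀ j, y j x = a j)
    {ρ : ℝ} (hρ : 0 < ρ) (hρK : ∀ x, (∀ j, y j x ≤ ρ) → x ∈ K) :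
    xi (polar K) K ≤ (2 + 2 / (n : ℝ)) / ρ := by
  have hn0 : (0 : ℝ) < n := Nat.cast_pos.2 hn
  -- Equally spaced values from `1` to `-1` sum to zero; cyclically, each step falls by `2 / n`
  -- except for one jump up by `2`.
  set a : Fin (n + 1) → ℝ := fun k => 1 - 2 * k / n with ha
  have hsum : ∑ k, a k = 0 := by
    simp only [ha, Finset.sum_sub_distrib, ← Finset.sum_div, ← Finset.mul_sum]
    have : ∑ k : Fin (n + 1), ((k : ℕ) : ℝ) = n * (n + 1) / 2 := by
      rw [Fin.sum_univ_eq_sum_range (fun k : ℕ => (k : ℝ))]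
      have := Finset.sum_range_id_mul_two (n + 1)
      have h2 : (∑ k ∈ Finset.range (n + 1), (k : ℝ)) * 2 = (n + 1) * n := by
        have := congrArg (Nat.cast : ℕ → ℝ) this
        push_cast at this
        simpa using this
      linarith
    rw [this]
    simp
    field_simp
    ring
  have hstep : ∀ k, a (k - 1) - a k ≤ 2 / n := by
    intro k
    induction k using Fin.cases with
    | zero =>
      have : (0 : Fin (n + 1)) - 1 = Fin.last n := by
        rw [sub_eq_iff_eq_add, Fin.last_add_one]
      rw [this]
      simp only [ha, Fin.val_last, Fin.val_zero]
      have : 2 * (n : ℝ) / n = 2 := by field_simp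
      have h3 : (0 : ℝ) ≤ 2 / n := by positivity
      simp only [this]
      norm_num
      linarith
    | succ i =>
      have : i.succ - 1 = i.castSucc := by
        rw [sub_eq_iff_eq_add, Fin.coeSucc_eq_succ]
      rw [this]
      simp only [ha, Fin.val_castSucc, Fin.val_succ]
      push_cast
      apply le_of_eq
      ring
  have hq : ∀ i : Fin (n + 1), ∃ x, ∀ j, y j x = a (j - i) := by
    intro i
    apply hex
    rw [← hsum]
    exact Equiv.sum_comp (Equiv.subRight i) a
  choose q hq using hq
  -- Vertex `i` lies on the facet `y i = 1`, so fitting strictly after a shift by `t` would make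
  -- every `y i t` positive, against their zero sum.
  have hunfit : q ∈ unfit (n + 1) K := by
    rw [hK.mem_unfit_iff]
    by_contra! hcon
    obtain ⟨t, ht⟩ := hcon
    have h1 : ∀ i, 1 - y i t < 1 := by
      intro i
      obtain ⟨r, hr0, hr1⟩ := exists_between (ht i)
      have hr : 0 < r := (gauge_nonneg _).trans_lt hr0
      have := hy1 _ ((hK.gauge_le_iff hr).1 hr0.le) i
      rw [map_smul, map_sub, hq, sub_self, smul_eq_mul, inv_mul_le_iff₀ hr] at this
      have ha0 : a 0 = 1 := by simp [ha]
      rw [ha0] at this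
      linarith
    have h2 : 0 < ∑ i, y i t :=
      Finset.sum_pos (fun i _ => by linarith [h1 i]) Finset.univ_nonempty
    exact h2.ne' (hy t)
  refine (csInf_le (bddBelow_unfitLengths _ _) ⟨n + 1, by omega, q, hunfit, rfl⟩).trans ?_
  rw [hK.closedLength_polar]
  have hedge : ∀ i, gauge K (q (finRotate (n + 1) i) - q i) ≤ 2 / n / ρ := by
    intro i
    rw [hK.gauge_le_iff (by positivity)]
    apply hρK
    intro j
    rw [finRotate_apply, map_smul, map_sub, hq, hq, smul_eq_mul,
      inv_mul_le_iff₀ (by positivity), div_mul_cancel₀ _ hρ.ne']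
    rw [← sub_sub j i 1]
    exact hstep (j - i)
  calc _ ≤ ∑ _i : Fin (n + 1), 2 / (n : ℝ) / ρ := Finset.sum_le_sum fun i _ => hedge i
    _ = (2 + 2 / (n : ℝ)) / ρ := by
      simp
      field_simp

end IsBodyAroundZero

end

/-! ### Simplices with barycenter at the origin. -/

section Simplex

variable {V : Type*} [NormedAddCommGroup V] [NormedSpace ℝ V]

theorem coord_zero_of_sum_eq_zero {n : ℕ} (b : AffineBasis (Fin (n + 1)) ℝ V)
    (hb : ∑ i, b i = 0) (i : Fin (n + 1)) : b.coord i 0 = ((n : ℝ) + 1)⁻¹ := by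
  have h1 : ∑ j, b.coord i (b j) = 1 := by
    simp [AffineBasis.coord_apply]
  have h2 : ∀ x, b.coord i x = (b.coord i).linear x + b.coord i 0 := fun x => by
    have := (b.coord i).map_vadd 0 x
    simpa using this
  simp only [h2 (b _), Finset.sum_add_distrib, ← map_sum, hb, map_zero] at h1
  have h3 : ((n : ℝ) + 1) * b.coord i 0 = 1 := by simpa using h1
  exact eq_inv_of_mul_eq_one_right h3

theorem isBodyAroundZero_convexHull_basis {n : ℕ} (b : AffineBasis (Fin (n + 1)) ℝ V)
    (hb : ∑ i, b i = 0) : IsBodyAroundZero (convexHull ℝ (Set.range b)) where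
  convex := convex_convexHull _ _
  isCompact := (Set.finite_range b).isCompact_convexHull ℝ
  zero_mem_interior := by
    rw [b.interior_convexHull, Set.mem_ofPred_eq]
    intro i
    rw [coord_zero_of_sum_eq_zero b hb]
    positivity

theorem xi_convexHull_basis {n : ℕ} (hn : 1 ≤ n) (b : AffineBasis (Fin (n + 1)) ℝ V)
    (hb : ∑ i, b i = 0) :
    xi (polar (convexHull ℝ (Set.range b))) (convexHull ℝ (Set.range b)) ≤ 2 + 2 / (n : ℝ) := by
  have hK := isBodyAroundZero_convexHull_basis b hb
  have hn0 : (0 : ℝ) < n + 1 := by positivity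
  have hlin : ∀ i x, (b.coord i).linear x = b.coord i x - ((n : ℝ) + 1)⁻¹ := fun i x => by
    rw [← coord_zero_of_sum_eq_zero b hb i]
    have := (b.coord i).map_vadd 0 x
    rw [eq_sub_iff_add_eq]
    simpa using this.symm
  have hy : ∀ i x, (-((n : ℝ) + 1) • (b.coord i).linear) x = 1 - (n + 1) * b.coord i x := by
    intro i x
    rw [LinearMap.smul_apply, hlin, smul_eq_mul]
    field_simp
    ring
  have hmem : ∀ x, x ∈ convexHull ℝ (Set.range b) ↔ ∀ i, 0 ≤ b.coord i x := fun x => by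
    rw [b.convexHull_eq_nonneg_coord]; rfl
  -- These forms equal `1 - (n + 1) * b.coord i`, so `y i ≤ 1` means a nonnegative barycentric
  -- coordinate, and `ρ = 1` is allowed.
  have := hK.xi_le hn (fun i => -((n : ℝ) + 1) • (b.coord i).linear) ?_ ?_ ?_ one_pos ?_
  · simpa using this
  · intro x
    simp only [hy, Finset.sum_sub_distrib, ← Finset.mul_sum, b.sum_coord_apply_eq_one]
    simp
  · intro x hx j
    rw [hy]
    have := mul_nonneg hn0.le ((hmem x).1 hx j)
    linarith
  · intro a ha
    refine ⟨∑ k, (-(a k) / (n + 1)) • b k, fun j => ?_⟩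
    change (-((n : ℝ) + 1) • (b.coord j).linear) _ = _
    have hk : ∀ k, (-((n : ℝ) + 1) • (b.coord j).linear) ((-(a k) / (n + 1)) • b k) =
        (if j = k then a k else 0) - a k / (n + 1) := by
      intro k
      rw [map_smul, hy, AffineBasis.coord_apply, smul_eq_mul]
      split_ifs <;> field_simp <;> ring
    rw [map_sum, Finset.sum_congr rfl fun k _ => hk k, Finset.sum_sub_distrib, ← Finset.sum_div, ha]
    simp
  · intro x hx
    rw [hmem]
    intro i
    have := hx i
    rw [hy] at this
    by_contra! hneg
    nlinarith

end Simplex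

/-! ### Sublevel sets of sums of exponentials: convexity, smoothness, smooth polars. -/

section ExpSum

variable {V : Type*} [NormedAddCommGroup V] [NormedSpace ℝ V] {ι : Type*} [Fintype ι]
  (z : ι → StrongDual ℝ V)

/-- The sum of the exponentials of finitely many linear forms. -/
def expSum (x : V) : ℝ := ∑ i, Real.exp (z i x)

/-- The differential of `expSum`. -/
def expSumGrad (x : V) : StrongDual ℝ V := ∑ i, Real.exp (z i x) • z i

theorem contDiff_expSum : ContDiff ℝ ∞ (expSum z) := by
  unfold expSum
  fun_prop

theorem contDiff_expSumGrad : ContDiff ℝ ∞ (expSumGrad z) := by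
  unfold expSumGrad
  fun_prop

theorem hasFDerivAt_expSum (x : V) : HasFDerivAt (expSum z) (expSumGrad z x) x :=
  HasFDerivAt.fun_sum fun i _ => ((z i).hasFDerivAt).exp

theorem hasFDerivAt_expSumGrad (x : V) :
    HasFDerivAt (expSumGrad z) (∑ i, (Real.exp (z i x) • z i).smulRight (z i)) x :=
  HasFDerivAt.fun_sum fun i _ => ((z i).hasFDerivAt).exp.smul_const (z i)

/-- Convexity in tangent form, termwise from `1 + t ≤ exp t`. -/
theorem expSum_add_grad_le (x y : V) :
    expSum z x + expSumGrad z x (y - x) ≤ expSum z y := by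
  simp only [expSum, expSumGrad, sum_apply, smul_apply,
    smul_eq_mul, ← Finset.sum_add_distrib]
  refine Finset.sum_le_sum fun i _ => ?_
  have h1 := Real.add_one_le_exp (z i (y - x))
  have h2 : Real.exp (z i y) = Real.exp (z i x) * Real.exp (z i (y - x)) := by
    rw [← Real.exp_add, map_sub]; congr 1; ring
  rw [h2]
  nlinarith [Real.exp_pos (z i x)]

theorem expSum_zero : expSum z 0 = Fintype.card ι := by
  simp [expSum]

theorem expSumGrad_self_pos {x : V} (hx : (Fintype.card ι : ℝ) < expSum z x) :
    0 < expSumGrad z x x := by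
  have := expSum_add_grad_le z x 0
  rw [expSum_zero, zero_sub, map_neg] at this
  linarith

theorem convex_expSum_le (C : ℝ) : Convex ℝ {x | expSum z x ≤ C} := by
  intro x hx y hy a b ha hb hab
  simp only [Set.mem_ofPred_eq] at *
  have h1 := expSum_add_grad_le z (a • x + b • y) x
  have h2 := expSum_add_grad_le z (a • x + b • y) y
  set w := a • x + b • y
  have h3 : a * expSumGrad z w (x - w) + b * expSumGrad z w (y - w) = 0 := by
    rw [← smul_eq_mul, ← smul_eq_mul, ← map_smul, ← map_smul, ← map_add]
    have : a • (x - w) + b • (y - w) = (a • x + b • y) - (a + b) • w := by module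
    rw [this, hab, one_smul, sub_self, map_zero]
  have h4 := mul_le_mul_of_nonneg_left (h1.trans hx) ha
  have h5 := mul_le_mul_of_nonneg_left (h2.trans hy) hb
  have h6 : a * expSum z w + b * expSum z w = expSum z w := by rw [← add_mul, hab, one_mul]
  have h7 : a * C + b * C = C := by rw [← add_mul, hab, one_mul]
  linarith

variable {z} {C : ℝ}

theorem expSum_eq_of_mem_frontier {x : V} (hx : x ∈ frontier {x | expSum z x ≤ C}) :
    expSum z x = C :=
  frontier_le_subset_eq (contDiff_expSum z).continuous continuous_const hx

theorem hasSmoothBoundary_expSum_le (hC : Fintype.card ι < C) :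
    HasSmoothBoundary {x | expSum z x ≤ C} := by
  intro x hx
  have hxC := expSum_eq_of_mem_frontier hx
  refine ⟨Set.univ, isOpen_univ, trivial, fun x => expSum z x - C,
    ((contDiff_expSum z).sub contDiff_const).contDiffOn, ?_, fun y _ => ?_⟩
  · rw [((hasFDerivAt_expSum z x).sub_const C).fderiv]
    intro h
    have := expSumGrad_self_pos z (hC.trans_eq hxC.symm)
    rw [h] at this
    simp at this
  · simp

/-- A linear form that attains its maximum over the sublevel set is a multiple of the
differential. -/
theorem exists_eq_smul_expSumGrad (hC : Fintype.card ι < C) {p : StrongDual ℝ V} {x : V}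
    (hx : expSum z x ≤ C) (hpx : p x = 1) (hmax : ∀ y, expSum z y ≤ C → p y ≤ 1) :
    expSum z x = C ∧ ∃ s : ℝ, 0 < s ∧ p = s • expSumGrad z x := by
  -- A short move along such a `u` stays in the sublevel set, where `p` is maximal at `x`.
  have hray : ∀ u, expSumGrad z x u < 0 ∨ expSum z x < C → p u ≤ 0 := by
    intro u hu
    by_contra! hpu
    have hline : HasDerivAt (fun t : ℝ => expSum z (x + t • u)) (expSumGrad z x u) 0 := by
      have h1 : HasDerivAt (fun t : ℝ => x + t • u) u 0 := by
        simpa using ((hasDerivAt_id (0 : ℝ)).smul_const u).const_add x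
      have h2 : HasFDerivAt (expSum z) (expSumGrad z x) (x + (0 : ℝ) • u) := by
        simpa using hasFDerivAt_expSum z x
      exact h2.comp_hasDerivAt 0 h1
    have hev : ∃ t : ℝ, 0 < t ∧ expSum z (x + t • u) ≤ C := by
      rcases hu with hu | hu
      · have := (hasDerivAt_iff_tendsto_slope.1 hline).eventually (gt_mem_nhds hu)
        have h2 : ∀ᶠ t in nhdsWithin (0 : ℝ) (Set.Ioi 0),
            slope (fun t : ℝ => expSum z (x + t • u)) 0 t < 0 :=
          this.filter_mono (nhdsWithin_mono _ fun t ht => ne_of_gt ht)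
        obtain ⟨t, h3, ht⟩ := (h2.and self_mem_nhdsWithin).exists
        have ht : 0 < t := ht
        refine ⟨t, ht, ?_⟩
        rw [slope_def_field] at h3
        rw [div_neg_iff] at h3
        simp only [sub_zero, zero_smul, add_zero] at h3
        rcases h3 with h3 | h3 <;> linarith
      · have : ∀ᶠ t in nhds (0 : ℝ), expSum z (x + t • u) < C :=
          hline.continuousAt.eventually (gt_mem_nhds (by simpa using hu))
        have h2 := this.filter_mono (nhdsWithin_le_nhds (s := Set.Ioi 0))
        obtain ⟨t, h3, ht⟩ := (h2.and self_mem_nhdsWithin).exists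
        exact ⟨t, ht, h3.le⟩
    obtain ⟨t, ht, h⟩ := hev
    have := hmax _ h
    rw [map_add, map_smul, hpx, smul_eq_mul] at this
    nlinarith
  have hxC : expSum z x = C := by
    by_contra hne
    have := hray x (Or.inr (lt_of_le_of_ne hx hne))
    rw [hpx] at this
    linarith
  have hpos := expSumGrad_self_pos z (hC.trans_eq hxC.symm)
  have hker : ∀ u, expSumGrad z x u = 0 → p u ≤ 0 := by
    intro u hu
    refine le_of_forall_pos_le_add fun η hη => ?_
    -- Tilting a tangent vector slightly inward makes it admissible; `η` then tends to `0`.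
    have := hray (u - η • x) (Or.inl (by
      rw [map_sub, map_smul, hu, smul_eq_mul]
      have := mul_pos hη hpos
      linarith))
    rw [map_sub, map_smul, hpx, smul_eq_mul, mul_one] at this
    linarith
  refine ⟨hxC, (expSumGrad z x x)⁻¹, inv_pos.2 hpos, ?_⟩
  ext v
  set c := expSumGrad z x v / expSumGrad z x x with hc
  have h0 : expSumGrad z x (v - c • x) = 0 := by
    rw [map_sub, map_smul, smul_eq_mul, hc, div_mul_cancel₀ _ hpos.ne', sub_self]
  have h1 := hker _ h0
  have h2 := hker (-(v - c • x)) (by rw [map_neg, h0, neg_zero])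
  rw [map_neg] at h2
  have h3 : p (v - c • x) = 0 := by linarith
  rw [map_sub, map_smul, hpx, smul_eq_mul, mul_one, sub_eq_zero] at h3
  rw [h3, hc, smul_apply, smul_eq_mul, div_eq_inv_mul]

/-- The map sending `x` and a multiplier `s` to the linear form `s • dΦ x` and the value `Φ x`, for
`Φ = expSum z`. -/
def multiplierMap (z : ι → StrongDual ℝ V) (w : V × ℝ) : StrongDual ℝ V × ℝ :=
  (w.2 • expSumGrad z w.1, expSum z w.1)

theorem contDiff_multiplierMap : ContDiff ℝ ∞ (multiplierMap z) :=
  (contDiff_snd.smul ((contDiff_expSumGrad z).comp contDiff_fst)).prodMk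
    ((contDiff_expSum z).comp contDiff_fst)

/-- The derivative is a bordered Hessian. For `(u, σ)` in its kernel, pairing with `u` leaves a
weighted sum of the squares `(z i u) ^ 2`, so `u = 0`; then `σ = 0` because the gradient is nonzero.
-/
theorem exists_hasFDerivAt_multiplierMap [FiniteDimensional ℝ V]
    (hz : ∀ u, (∀ i, z i u = 0) → u = 0) {w : V × ℝ} (hs : 0 < w.2)
    (hw : Fintype.card ι < expSum z w.1) :
    ∃ f : (V × ℝ) ≃L[ℝ] (StrongDual ℝ V × ℝ),
      HasFDerivAt (multiplierMap z) (f : (V × ℝ) →L[ℝ] (StrongDual ℝ V × ℝ)) w := by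
  set Q : V →L[ℝ] StrongDual ℝ V := ∑ i, (Real.exp (z i w.1) • z i).smulRight (z i) with hQ
  set D : (V × ℝ) →L[ℝ] (StrongDual ℝ V × ℝ) :=
    (w.2 • Q.comp (ContinuousLinearMap.fst ℝ V ℝ) +
      (ContinuousLinearMap.snd ℝ V ℝ).smulRight (expSumGrad z w.1)).prod
    ((expSumGrad z w.1).comp (ContinuousLinearMap.fst ℝ V ℝ)) with hD
  have h : HasFDerivAt (multiplierMap z) D w :=
    ((hasFDerivAt_snd (𝕜 := ℝ)).smul
      ((hasFDerivAt_expSumGrad z w.1).comp w (hasFDerivAt_fst (𝕜 := ℝ)))).prodMk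
      ((hasFDerivAt_expSum z w.1).comp w (hasFDerivAt_fst (𝕜 := ℝ)))
  have hinj : Function.Injective (D : (V × ℝ) →ₗ[ℝ] (StrongDual ℝ V × ℝ)) := by
    rw [← LinearMap.ker_eq_bot, LinearMap.ker_eq_bot']
    rintro ⟨u, σ⟩ hu
    have e1 : w.2 • Q u + σ • expSumGrad z w.1 = 0 := congrArg Prod.fst hu
    have e2 : expSumGrad z w.1 u = 0 := congrArg Prod.snd hu
    have e3 : w.2 * Q u u + σ * expSumGrad z w.1 u = 0 :=
      congrArg (fun p : StrongDual ℝ V => p u) e1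
    rw [e2, mul_zero, add_zero] at e3
    have e4 : Q u u = ∑ i, Real.exp (z i w.1) * z i u * z i u := by
      simp [hQ, sum_apply]
    have e5 : ∑ i, Real.exp (z i w.1) * z i u * z i u = 0 := by
      rw [← e4]
      exact (mul_eq_zero.1 e3).resolve_left hs.ne'
    have hu0 : u = 0 := by
      apply hz
      intro i
      have := (Finset.sum_eq_zero_iff_of_nonneg fun i _ => by
        rw [mul_assoc]
        exact mul_nonneg (Real.exp_pos _).le (mul_self_nonneg _)).1 e5 i (Finset.mem_univ i)
      simpa [(Real.exp_pos _).ne'] using this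
    rw [hu0, map_zero, smul_zero, zero_add] at e1
    have hg : expSumGrad z w.1 ≠ 0 := fun h => by
      have := expSumGrad_self_pos z hw
      rw [h] at this
      simp at this
    rw [hu0, (smul_eq_zero.1 e1).resolve_right hg]
    rfl
  have hfr : Module.finrank ℝ (V × ℝ) = Module.finrank ℝ (StrongDual ℝ V × ℝ) := by
    rw [Module.finrank_prod, Module.finrank_prod,
      ← (LinearMap.toContinuousLinearMap (𝕜 := ℝ) (E := V) (F' := ℝ)).finrank_eq]
    congr 1
    exact (Subspace.dual_finrank_eq (K := ℝ) (V := V)).symm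
  refine ⟨(LinearEquiv.ofInjectiveOfFinrankEq _ hinj hfr).toContinuousLinearEquiv, ?_⟩
  convert h
  ext <;> rfl

/-- Inverting `multiplierMap` gives the support point `ξ p'` as a smooth function of `p'`, so near
`p` the polar is cut out by the smooth support function `p' (ξ p') ≤ 1`. -/
theorem hasSmoothBoundary_polar_expSum_le [FiniteDimensional ℝ V]
    (hz : ∀ u, (∀ i, z i u = 0) → u = 0) (hC : Fintype.card ι < C)
    (hK : IsBodyAroundZero {x | expSum z x ≤ C}) :
    HasSmoothBoundary (polar {x | expSum z x ≤ C}) := by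
  intro p hp
  set K := {x | expSum z x ≤ C} with hKdef
  have hpK : p ∈ polar K := by
    have hcl : IsClosed (polar K) := by
      have : polar K = ⋂ x ∈ K, {p : StrongDual ℝ V | p x ≤ 1} := by
        ext p; simp [polar]
      rw [this]
      exact isClosed_biInter fun x _ =>
        isClosed_le (ContinuousLinearMap.apply ℝ ℝ x).continuous continuous_const
    exact hcl.frontier_subset hp
  obtain ⟨x, hxK, hmax⟩ := hK.isCompact.exists_isMaxOn ⟨0, hK.zero_mem⟩ p.continuous.continuousOn
  have hpx : p x = 1 := by
    refine le_antisymm (hpK x hxK) ?_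
    by_contra! hlt
    -- If the maximum of `p` were below `1`, all forms near `p` would lie in the polar, so `p` would
    -- be interior.
    obtain ⟨R, hR, hsub⟩ := hK.isCompact.isBounded.subset_closedBall_lt 0 (0 : V)
    refine hp.2 (mem_interior_iff_mem_nhds.2 ?_)
    filter_upwards [Metric.ball_mem_nhds p (div_pos (sub_pos.2 hlt) hR)] with p' hp' y hy
    rw [mem_ball_iff_norm, lt_div_iff₀ hR] at hp'
    have h1 := (le_abs_self _).trans ((p' - p).le_opNorm y)
    have h2 : ‖y‖ ≤ R := by simpa using hsub hy
    have h3 := mul_le_mul_of_nonneg_left h2 (norm_nonneg (p' - p))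
    have h4 : p y ≤ p x := isMaxOn_iff.1 hmax y hy
    rw [sub_apply] at h1
    linarith
  obtain ⟨hxC, s, hs, hps⟩ := exists_eq_smul_expSumGrad hC hxK hpx fun y hy => hpK y hy
  obtain ⟨f, hf⟩ := exists_hasFDerivAt_multiplierMap hz (w := (x, s)) hs (hC.trans_eq hxC.symm)
  have hcd := contDiff_multiplierMap (z := z)
  have hval : multiplierMap z (x, s) = (p, C) := by
    rw [multiplierMap, ← hps, hxC]
  set F := hcd.contDiffAt.toOpenPartialHomeomorph (multiplierMap z) hf (by simp) with hF
  have hFcoe : ∀ w, F w = multiplierMap z w := fun w => rfl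
  have hsrc : (x, s) ∈ F.source :=
    hcd.contDiffAt.mem_toOpenPartialHomeomorph_source hf (by simp)
  have hleft : F.symm (p, C) = (x, s) := by
    rw [← hval, ← hFcoe, F.left_inv hsrc]
  set W : Set (V × ℝ) := {w | 0 < w.2 ∧ (Fintype.card ι : ℝ) < expSum z w.1} with hW
  have hWo : IsOpen W :=
    (isOpen_lt continuous_const continuous_snd).inter
      (isOpen_lt continuous_const ((contDiff_expSum z).continuous.comp continuous_fst))
  set U : Set (StrongDual ℝ V) :=
    (fun p' => (p', C)) ⁻¹' (F.target ∩ F.symm ⁻¹' W) with hU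
  have hUo : IsOpen U :=
    (F.isOpen_inter_preimage_symm hWo).preimage (by fun_prop)
  have hpU : p ∈ U := by
    refine ⟨?_, ?_⟩
    · change (p, C) ∈ F.target
      rw [← hval, ← hFcoe]
      exact F.map_source hsrc
    · change F.symm (p, C) ∈ W
      rw [hleft]
      exact ⟨hs, hC.trans_eq hxC.symm⟩
  set ξ : StrongDual ℝ V → V := fun p' => (F.symm (p', C)).1 with hξ
  -- With a positive multiplier, the tangent inequality turns the critical point into a global
  -- maximizer.
  have hsolve : ∀ p' ∈ U, ξ p' ∈ K ∧ ∀ y ∈ K, p' y ≤ p' (ξ p') := by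
    intro p' hp'
    have h1 : multiplierMap z (F.symm (p', C)) = (p', C) := by
      rw [← hFcoe, F.right_inv hp'.1]
    have h2 : (F.symm (p', C)).2 • expSumGrad z (ξ p') = p' := congrArg Prod.fst h1
    have h3 : expSum z (ξ p') = C := congrArg Prod.snd h1
    refine ⟨h3.le, fun y hy => ?_⟩
    have h4 := (expSum_add_grad_le z (ξ p') y).trans hy
    rw [h3, map_sub] at h4
    have h5 : 0 < (F.symm (p', C)).2 := hp'.2.1
    rw [← h2, smul_apply, smul_apply, smul_eq_mul, smul_eq_mul, h2]
    exact mul_le_mul_of_nonneg_left (by linarith) h5.le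
  have hξd : ContDiffOn ℝ ∞ ξ U := by
    intro p' hp'
    obtain ⟨f', hf'⟩ := exists_hasFDerivAt_multiplierMap hz hp'.2.1 hp'.2.2
    have h1 : ContDiffAt ℝ ∞ F.symm (p', C) := F.contDiffAt_symm hp'.1 hf' hcd.contDiffAt
    have h2 : ContDiffAt ℝ ∞ (fun p' : StrongDual ℝ V => (p', C)) p' := by fun_prop
    exact (contDiffAt_fst.comp p' (h1.comp p' h2)).contDiffWithinAt
  have hφd : ContDiffOn ℝ ∞ (fun p' : StrongDual ℝ V => p' (ξ p') - 1) U :=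
    (contDiffOn_id.clm_apply hξd).sub contDiffOn_const
  refine ⟨U, hUo, hpU, fun p' => p' (ξ p') - 1, hφd, ?_, fun p' hp' => ?_⟩
  · intro h0
    have hd : HasFDerivAt (fun p' : StrongDual ℝ V => p' (ξ p') - 1)
        (0 : StrongDual ℝ V →L[ℝ] ℝ) p := by
      rw [← h0]
      exact ((hφd.contDiffAt (hUo.mem_nhds hpU)).differentiableAt (by simp)).hasFDerivAt
    have hline : HasDerivAt (fun t : ℝ => t • p) p 1 := by
      simpa using (hasDerivAt_id (1 : ℝ)).smul_const p
    have hd' : HasFDerivAt (fun p' : StrongDual ℝ V => p' (ξ p') - 1)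
        (0 : StrongDual ℝ V →L[ℝ] ℝ) ((1 : ℝ) • p) := by rwa [one_smul]
    have hcomp := hd'.comp_hasDerivAt 1 hline
    -- The support function is homogeneous of degree one, so along the ray `t • p` it equals `t` and
    -- its derivative is not zero.
    have hev : (fun t : ℝ => t - 1) =ᶠ[nhds 1]
        (fun p' : StrongDual ℝ V => p' (ξ p') - 1) ∘ fun t : ℝ => t • p := by
      have hmem : ∀ᶠ t in nhds (1 : ℝ), t • p ∈ U :=
        hline.continuousAt.eventually (hUo.mem_nhds (by simpa using hpU))
      filter_upwards [hmem, lt_mem_nhds one_pos] with t ht ht0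
      obtain ⟨h1, h2⟩ := hsolve _ ht
      have h3 := h2 x hxK
      have h4 := hpK _ h1
      simp only [smul_apply, smul_eq_mul, hpx, Function.comp] at h3 ⊢
      nlinarith
    have h5 := (hcomp.congr_of_eventuallyEq hev).unique ((hasDerivAt_id (1 : ℝ)).sub_const 1)
    simp at h5
  · obtain ⟨h1, h2⟩ := hsolve p' hp'
    rw [sub_nonpos]
    exact ⟨fun h => h _ h1, fun h y hy => (h2 y hy).trans h⟩

end ExpSum

/-! ### Smooth approximation of a simplex. -/

section CornerForm

/-- The coordinate forms and minus their sum: the linear forms bounding a simplex. -/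
def cornerForm (n : ℕ) : Fin (n + 1) → StrongDual ℝ (EuclideanSpace ℝ (Fin n)) :=
  Fin.snoc (fun i => EuclideanSpace.proj i) (-∑ i, EuclideanSpace.proj i)

variable {n : ℕ}

@[simp]
theorem cornerForm_castSucc (i : Fin n) (x : EuclideanSpace ℝ (Fin n)) :
    cornerForm n i.castSucc x = x i := by
  simp [cornerForm]

@[simp]
theorem cornerForm_last (x : EuclideanSpace ℝ (Fin n)) :
    cornerForm n (Fin.last n) x = -∑ i, x i := by
  simp [cornerForm, sum_apply]

theorem sum_cornerForm (x : EuclideanSpace ℝ (Fin n)) : ∑ j, cornerForm n j x = 0 := by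
  simp [Fin.sum_univ_castSucc]

theorem exists_cornerForm_eq (a : Fin (n + 1) → ℝ) (ha : ∑ j, a j = 0) :
    ∃ x, ∀ j, cornerForm n j x = a j := by
  refine ⟨WithLp.toLp 2 fun i => a i.castSucc, fun j => ?_⟩
  induction j using Fin.lastCases with
  | last =>
    rw [Fin.sum_univ_castSucc] at ha
    simp only [cornerForm_last]
    linarith
  | cast i => simp

theorem isBounded_cornerForm_le_one :
    Bornology.IsBounded {x : EuclideanSpace ℝ (Fin n) | ∀ j, cornerForm n j x ≤ 1} := by
  refine (Metric.isBounded_iff_subset_closedBall 0).2 ⟨√(n * (n + 1) ^ 2), fun x hx => ?_⟩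
  rw [mem_closedBall_zero_iff]
  refine Real.le_sqrt_of_sq_le ?_
  rw [EuclideanSpace.norm_sq_eq]
  have h1 : ∀ i, x i ≤ 1 := fun i => by simpa using hx i.castSucc
  have h2 : -∑ i, x i ≤ 1 := by simpa using hx (Fin.last n)
  have h3 : ∀ i, |x i| ≤ n + 1 := by
    intro i
    have hn : (0 : ℝ) ≤ n := n.cast_nonneg
    -- All terms are nonnegative and the sum is at most `n + 1`, which bounds `x i` from below.
    have h4 : 1 - x i ≤ ∑ k, (1 - x k) :=
      Finset.single_le_sum (f := fun k => 1 - x k) (fun k _ => by linarith [h1 k])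
        (Finset.mem_univ i)
    rw [Finset.sum_sub_distrib] at h4
    simp only [Finset.sum_const, Finset.card_univ, Fintype.card_fin, nsmul_eq_mul, mul_one] at h4
    rw [abs_le]
    exact ⟨by linarith, by linarith [h1 i]⟩
  calc ∑ i, ‖x i‖ ^ 2 ≤ ∑ _i : Fin n, ((n : ℝ) + 1) ^ 2 :=
        Finset.sum_le_sum fun i _ => pow_le_pow_left₀ (norm_nonneg _) (h3 i) 2
    _ = n * (n + 1) ^ 2 := by simp

/-- Smooth bodies with smooth polars whose shortest length is nearly minimal. -/
theorem exists_smooth_xi_lt (hn : 1 ≤ n) {ε : ℝ} (hε : 0 < ε) :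
    ∃ K : Set (EuclideanSpace ℝ (Fin n)), IsBodyAroundZero K ∧ HasSmoothBoundary K ∧
      HasSmoothBoundary (polar K) ∧ xi (polar K) K < 2 + 2 / (n : ℝ) + ε := by
  have hn0 : (0 : ℝ) < n := Nat.cast_pos.2 hn
  set c : ℝ := 2 + 2 / n with hc
  have hc0 : 0 < c := by positivity
  obtain ⟨ρ, hρ0, hρ1, hρ⟩ : ∃ ρ : ℝ, 0 < ρ ∧ ρ < 1 ∧ c / ρ < c + ε := by
    refine ⟨c / (c + ε / 2), by positivity, ?_, ?_⟩
    · rw [div_lt_one (by positivity)]; linarith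
    · rw [div_div_cancel₀ hc0.ne']; linarith
  -- With this `N`, the `n + 1` exponentials on `ρ` times the simplex sum to at most `exp N`.
  obtain ⟨N, hN, hexp⟩ : ∃ N : ℝ, 0 < N ∧ (n : ℝ) + 1 < Real.exp (N * (1 - ρ)) := by
    have h1 : 0 < 1 - ρ := sub_pos.2 hρ1
    refine ⟨(n + 1) / (1 - ρ), by positivity, ?_⟩
    rw [div_mul_cancel₀ _ h1.ne']
    have := Real.add_one_le_exp ((n : ℝ) + 1)
    linarith
  set z : Fin (n + 1) → StrongDual ℝ (EuclideanSpace ℝ (Fin n)) := fun j => N • cornerForm n j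
    with hz
  have hzj : ∀ j x, z j x = N * cornerForm n j x := fun j x => rfl
  have hC : (Fintype.card (Fin (n + 1)) : ℝ) < Real.exp N := by
    rw [Fintype.card_fin]
    push_cast
    refine hexp.trans (Real.exp_lt_exp.2 ?_)
    nlinarith
  have hle : ∀ x, expSum z x ≤ Real.exp N → ∀ j, cornerForm n j x ≤ 1 := by
    intro x hx j
    have h1 : Real.exp (z j x) ≤ expSum z x :=
      Finset.single_le_sum (f := fun j => Real.exp (z j x)) (fun _ _ => (Real.exp_pos _).le)
        (Finset.mem_univ j)
    have h2 := Real.exp_le_exp.1 (h1.trans hx)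
    rw [hzj] at h2
    nlinarith
  have hcont : Continuous (expSum z) := (contDiff_expSum z).continuous
  have hK : IsBodyAroundZero {x | expSum z x ≤ Real.exp N} := by
    refine ⟨convex_expSum_le z _, ?_, ?_⟩
    · exact Metric.isCompact_of_isClosed_isBounded (isClosed_le hcont continuous_const)
        (isBounded_cornerForm_le_one.subset hle)
    · refine mem_interior.2 ⟨{x | expSum z x < Real.exp N}, fun x (hx : expSum z x < Real.exp N) => hx.le,
        isOpen_lt hcont continuous_const, ?_⟩
      rw [Set.mem_ofPred_eq, expSum_zero]
      exact hC
  refine ⟨_, hK, hasSmoothBoundary_expSum_le hC, hasSmoothBoundary_polar_expSum_le ?_ hC hK, ?_⟩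
  · intro u hu
    ext i
    have := hu i.castSucc
    rw [hzj, cornerForm_castSucc] at this
    exact (mul_eq_zero.1 this).resolve_left hN.ne'
  · refine lt_of_le_of_lt (hK.xi_le hn (fun j => (cornerForm n j).toLinearMap) sum_cornerForm hle
      exists_cornerForm_eq hρ0 fun x hx => ?_) hρ
    calc expSum z x ≤ ∑ _j : Fin (n + 1), Real.exp (N * ρ) :=
          Finset.sum_le_sum fun j _ => Real.exp_le_exp.2 (mul_le_mul_of_nonneg_left (hx j) hN.le)
      _ = (n + 1) * Real.exp (N * ρ) := by simp
      _ ≤ Real.exp (N * (1 - ρ)) * Real.exp (N * ρ) :=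
          mul_le_mul_of_nonneg_right hexp.le (Real.exp_pos _).le
      _ = Real.exp N := by rw [← Real.exp_add]; congr 1; ring

end CornerForm

end Billiard

end

theorem theorem3 (n : ℕ) (hn : 1 ≤ n) :
    -- the shortest length is attained, and it is bounded below, for every convex body
    (∀ K : Set (EuclideanSpace ℝ (Fin n)), Billiard.IsBodyAroundZero K →
      IsLeast (Billiard.unfitLengths (Billiard.polar K) K) (Billiard.xi (Billiard.polar K) K) ∧
      2 + 2 / (n : ℝ) ≤ Billiard.xi (Billiard.polar K) K) ∧
    -- equality for every simplex with barycenter at the origin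
    (∀ v : Fin (n + 1) → EuclideanSpace ℝ (Fin n), AffineIndependent ℝ v → ∑ i, v i = 0 →
      Billiard.IsBodyAroundZero (convexHull ℝ (Set.range v)) ∧
      Billiard.xi (Billiard.polar (convexHull ℝ (Set.range v))) (convexHull ℝ (Set.range v)) =
        2 + 2 / (n : ℝ)) ∧
    -- the constant is optimal among smooth bodies with smooth polars
    (∀ ε : ℝ, 0 < ε → ∃ K : Set (EuclideanSpace ℝ (Fin n)), Billiard.IsBodyAroundZero K ∧
      Billiard.HasSmoothBoundary K ∧ Billiard.HasSmoothBoundary (Billiard.polar K) ∧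
      Billiard.xi (Billiard.polar K) K < 2 + 2 / (n : ℝ) + ε) := by
  have hfr : Module.finrank ℝ (EuclideanSpace ℝ (Fin n)) = n := by simp
  have hnt : Nontrivial (EuclideanSpace ℝ (Fin n)) :=
    Module.nontrivial_of_finrank_pos (R := ℝ) (by omega)
  have hlow : ∀ K : Set (EuclideanSpace ℝ (Fin n)), Billiard.IsBodyAroundZero K →
      2 + 2 / (n : ℝ) ≤ Billiard.xi (Billiard.polar K) K := by
    intro K hK
    have := hK.le_xi
    rwa [hfr] at this
  refine ⟨fun K hK => ⟨hK.isLeast_xi, hlow K hK⟩, fun v hv hv0 => ?_,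
    fun ε hε => Billiard.exists_smooth_xi_lt hn hε⟩
  let b : AffineBasis (Fin (n + 1)) ℝ (EuclideanSpace ℝ (Fin n)) :=
    ⟨v, hv, hv.affineSpan_eq_top_iff_card_eq_finrank_add_one.2 (by simp)⟩
  have hK := Billiard.isBodyAroundZero_convexHull_basis b hv0
  exact ⟨hK, le_antisymm (Billiard.xi_convexHull_basis hn b hv0) (hlow _ hK)⟩
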